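/- All topological vector spaces are real, locally convex and Hausdorff; $E'$ denotes the topological dual of $E$. A representation of a group $G$ on a convex cone $C\subseteq E$ is a homomorphism from $G$ to the continuous linear operators on $E$ with $gC\subseteq C$ for all $g\in G$; $G$ acts on $E'$ by $(g\varphi)(x)=\varphi(g^{-1}x)$, and $E'$ carries the dual pre-order: $\varphi\le\psi$ iff $\varphi(x)\le\psi(x)$ for all $x\in C$. The cone $C$ is proper if $C\cap(-C)=\{0\}$, and weakly complete if it is complete for the weak uniform structure of $E$. The representation is of locally bounded type if some non-zero $x\in C$ has a bounded orbit $Gx$ (absorbed by every neighbourhood of $0$ in $E$), and of cobounded type if there is $\varphi\in E'$ such that for every $\lambda\in E'$ there are finitely many $g_1,\ldots,g_n\in G$ with $\pm\lambda\le\sum_{i=1}^n g_i\varphi$. The group $G$ has the fixed-point property for cones if every representation of $G$ of locally bounded and cobounded type on a weakly complete proper convex cone $C\subseteq E$ has a non-zero fixed point in $C$. **Proposition.** Let $G$ be a countable group. Suppose that every representation of $G$ of locally bounded and cobounded type on a weakly complete proper convex cone $C\subseteq E$, where $E$ is a space whose weak topology is first-countable, has a non-zero fixed point in $C$. Then $G$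 has the fixed-point property for cones. -/

import Mathlib

universe u v w

namespace ConeFPP

variable {G : Type u} [Group G] {E : Type v} [AddCommGroup E] [Module ℝ E] [TopologicalSpace E]

/-- The representation on the topological dual `E'` dual to `ρ`: `(g φ)(x) = φ (g⁻¹ x)`. -/
def dualAct (ρ : G →* (E →L[ℝ] E)) (g : G) (φ : E →L[ℝ] ℝ) : E →L[ℝ] ℝ :=
  φ.comp (ρ g⁻¹)

/-- The pre-order on the topological dual `E'` dual to the one defined by the cone `C`. -/
def DualLE (C : PointedCone ℝ E) (φ ψ : E →L[ℝ] ℝ) : Prop :=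
  ∀ x ∈ C, φ x ≤ ψ x

/-- `φ` `G`-dominates `ψ` in `E'`: there are finitely many `g i` (repetitions are allowed) with
`± ψ ≤ ∑ i, (g i) φ` in the dual pre-order. -/
def GDominates [IsTopologicalAddGroup E] (ρ : G →* (E →L[ℝ] E)) (C : PointedCone ℝ E)
    (φ ψ : E →L[ℝ] ℝ) : Prop :=
  ∃ (n : ℕ) (g : Fin n → G),
    DualLE C ψ (∑ i, dualAct ρ (g i) φ) ∧ DualLE C (-ψ) (∑ i, dualAct ρ (g i) φ)

/-- Every `ρ g` preserves the order of `E` defined by the cone `C`. -/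
def PreservesCone (ρ : G →* (E →L[ℝ] E)) (C : PointedCone ℝ E) : Prop :=
  ∀ g : G, ∀ x ∈ C, ρ g x ∈ C

/-- Locally bounded type: some non-zero point of the cone has a bounded orbit. -/
def LocallyBoundedType (ρ : G →* (E →L[ℝ] E)) (C : PointedCone ℝ E) : Prop :=
  ∃ x ∈ C, x ≠ 0 ∧ Bornology.IsVonNBounded ℝ (Set.range fun g : G => ρ g x)

/-- Cobounded type: some continuous linear form `G`-dominates every continuous linear form. -/
def CoboundedType [IsTopologicalAddGroup E] (ρ : G →* (E →L[ℝ] E)) (C : PointedCone ℝ E) : Prop :=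
  ∃ φ : E →L[ℝ] ℝ, ∀ ψ : E →L[ℝ] ℝ, GDominates ρ C φ ψ

/-- `C ∩ (-C) = {0}`. -/
def IsProperCone (C : PointedCone ℝ E) : Prop :=
  (C : Set E) ∩ -(C : Set E) = {0}

/-- The cone `C` is complete for the uniform structure of the weak topology of `E`. -/
def IsWeaklyComplete [IsTopologicalAddGroup E] [ContinuousSMul ℝ E] (C : PointedCone ℝ E) : Prop :=
  letI : UniformSpace (WeakSpace ℝ E) := IsTopologicalAddGroup.rightUniformSpace (WeakSpace ℝ E)
  IsComplete (toWeakSpace ℝ E '' (C : Set E))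

/-- `ρ` has a non-zero fixed point in the cone `C`. -/
def HasNonzeroFixedPoint (ρ : G →* (E →L[ℝ] E)) (C : PointedCone ℝ E) : Prop :=
  ∃ x ∈ C, x ≠ 0 ∧ ∀ g : G, ρ g x = x

end ConeFPP

/-- The fixed-point property for cones: every representation of `G` of locally bounded and
cobounded type on a weakly complete proper convex cone in a Hausdorff locally convex real
topological vector space has a non-zero fixed point in the cone. -/
def FixedPointPropertyForCones (G : Type u) [Group G] : Prop :=
  ∀ (E : Type v) [AddCommGroup E] [Module ℝ E] [TopologicalSpace E] [IsTopologicalAddGroup E]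
    [ContinuousSMul ℝ E] [LocallyConvexSpace ℝ E] [T2Space E]
    (C : PointedCone ℝ E) (ρ : G →* (E →L[ℝ] E)),
    ConeFPP.IsProperCone C → ConeFPP.IsWeaklyComplete C → ConeFPP.PreservesCone ρ C →
    ConeFPP.LocallyBoundedType ρ C → ConeFPP.CoboundedType ρ C →
    ConeFPP.HasNonzeroFixedPoint ρ C

/-- The fixed-point property for cones, restricted to cones in spaces whose weak topology is
first-countable. -/
def FixedPointPropertyForConesWeaklyFirstCountable (G : Type u) [Group G] : Prop :=
  ∀ (E : Type v) [AddCommGroup E] [Module ℝ E] [TopologicalSpace E] [IsTopologicalAddGroup E]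
    [ContinuousSMul ℝ E] [LocallyConvexSpace ℝ E] [T2Space E]
    [FirstCountableTopology (WeakSpace ℝ E)]
    (C : PointedCone ℝ E) (ρ : G →* (E →L[ℝ] E)),
    ConeFPP.IsProperCone C → ConeFPP.IsWeaklyComplete C → ConeFPP.PreservesCone ρ C →
    ConeFPP.LocallyBoundedType ρ C → ConeFPP.CoboundedType ρ C →
    ConeFPP.HasNonzeroFixedPoint ρ C

/-! By Hahn–Banach, a weakly complete cone `C` is the set of all linear forms on `E'` that are
non-negative on the dual cone (`exists_eval_eq`). A fixed point is therefore an invariant positive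
form on `E'`, non-zero once it is normalised at the dominating `φ`. As `G` is countable, finitely
many elements of `E'` lie in an invariant subspace `V` of countable dimension. The algebraic dual of
`V` is a countable product of lines, first-countable for its weak topology, and its positive forms
make a closed cone to which the hypothesis applies (`exists_invariant_of_basis`). Domination by `φ`
bounds the normalised forms at each vector independently of `V`, so they have a limit along an
ultrafilter (`exists_invariant`). -/

open Filter Topology

section Product

variable {I : Type*}

/-- A continuous linear form on a product of lines depends on finitely many coordinates. -/
theorem ContinuousLinearMap.exists_finset_pi_apply_eq_sum (f : (I → ℝ) →L[ℝ] ℝ) :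
    ∃ (s : Finset I) (c : I → ℝ), ∀ x, f x = ∑ i ∈ s, c i * x i := by
  classical
  have hU : f ⁻¹' Metric.ball 0 1 ∈ 𝓝 (0 : I → ℝ) :=
    f.continuous.continuousAt.preimage_mem_nhds (by simpa using Metric.ball_mem_nhds (0 : ℝ) one_pos)
  rw [nhds_pi, Filter.mem_pi'] at hU
  obtain ⟨s, t, ht, hst⟩ := hU
  have hsmall : ∀ x : I → ℝ, (∀ i ∈ s, x i = 0) → |f x| < 1 := fun x hx => by
    have : x ∈ (s : Set I).pi t := fun i hi => by
      rw [hx i hi]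
      exact mem_of_mem_nhds (ht i)
    simpa using hst this
  -- A form bounded on a linear subspace vanishes there.
  have hzero : ∀ x : I → ℝ, (∀ i ∈ s, x i = 0) → f x = 0 := fun x hx => by
    by_contra hne
    have := hsmall ((f x)⁻¹ • x) fun i hi => by simp [hx i hi]
    rw [map_smul, smul_eq_mul, inv_mul_cancel₀ hne] at this
    simp at this
  refine ⟨s, fun i => f (Pi.single i 1), fun x => ?_⟩
  have := hzero (x - ∑ i ∈ s, x i • Pi.single i 1) fun j hj => by
    simp [Finset.sum_apply, Pi.single_apply, hj]
  rw [map_sub, map_sum, sub_eq_zero] at this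
  rw [this]
  exact Finset.sum_congr rfl fun i _ => by rw [map_smul, smul_eq_mul, mul_comm]

/-- The product topology on `I → ℝ` is its own weak topology. -/
theorem isHomeomorph_toWeakSpace_pi : IsHomeomorph (toWeakSpace ℝ (I → ℝ)) := by
  refine (Homeomorph.mk (toWeakSpace ℝ (I → ℝ)).toEquiv (toWeakSpaceCLM ℝ (I → ℝ)).continuous
    ?_).isHomeomorph
  refine continuous_pi fun i => ?_
  exact WeakBilin.eval_continuous (topDualPairing ℝ (I → ℝ)).flip
    (ContinuousLinearMap.proj (R := ℝ) (φ := fun _ : I => ℝ) i)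

theorem firstCountableTopology_weakSpace_pi [Countable I] :
    FirstCountableTopology (WeakSpace ℝ (I → ℝ)) :=
  let e := (isHomeomorph_toWeakSpace_pi (I := I)).homeomorph
  e.symm.isInducing.firstCountableTopology

theorem ConeFPP.isWeaklyComplete_pi {C : PointedCone ℝ (I → ℝ)}
    (hC : IsClosed (C : Set (I → ℝ))) : ConeFPP.IsWeaklyComplete C := by
  unfold ConeFPP.IsWeaklyComplete
  let : UniformSpace (WeakSpace ℝ (I → ℝ)) :=
    IsTopologicalAddGroup.rightUniformSpace (WeakSpace ℝ (I → ℝ))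
  have : IsUniformAddGroup (WeakSpace ℝ (I → ℝ)) := isUniformAddGroup_of_addCommGroup
  have := AddMonoidHom.isUniformInducing_of_isInducing
    (isHomeomorph_toWeakSpace_pi (I := I)).isInducing
  exact (isComplete_image_iff this).2 hC.isComplete

end Product

/-! ### Invariant functionals in countable dimension -/

/-- If `φ` is an order unit up to `G`-translates in a space of countable dimension, and a non-zero
positive functional has a pointwise bounded orbit, then some invariant positive functional takes the
value `1` at `φ`: it is a fixed point in the cone of positive functionals. -/
theorem exists_invariant_of_basis {G : Type u} [Group G] {V : Type*} [AddCommGroup V] [Module ℝ V]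
    {I : Type v} [Countable I] (b : Module.Basis I ℝ V)
    (h : FixedPointPropertyForConesWeaklyFirstCountable.{u, v} G)
    (σ : G →* (V →ₗ[ℝ] V)) (P : Set V) (hP : ∀ g, ∀ p ∈ P, σ g p ∈ P) (φ : V)
    (hφ : ∀ v, ∃ (n : ℕ) (g : Fin n → G),
      ∑ i, σ (g i) φ - v ∈ P ∧ ∑ i, σ (g i) φ + v ∈ P)
    (f₀ : V →ₗ[ℝ] ℝ) (hf₀ : f₀ ≠ 0) (hf₀P : ∀ p ∈ P, 0 ≤ f₀ p)
    (hbdd : ∀ v, ∃ M : ℝ, ∀ g, |f₀ (σ g v)| ≤ M) :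
    ∃ f : V →ₗ[ℝ] ℝ, (∀ p ∈ P, 0 ≤ f p) ∧ (∀ g v, f (σ g v) = f v) ∧ f φ = 1 := by
  have := firstCountableTopology_weakSpace_pi (I := I)
  -- `I → ℝ` plays the algebraic dual of `V`, in coordinates on `b`; `ev` identifies `V` with its
  -- topological dual.
  let ev : V →ₗ[ℝ] ((I → ℝ) →L[ℝ] ℝ) :=
    b.constr ℝ fun i => ContinuousLinearMap.proj (R := ℝ) (φ := fun _ : I => ℝ) i
  have ev_basis : ∀ i x, ev (b i) x = x i := fun i x => by simp [ev]
  have ev_repr : ∀ f : V →ₗ[ℝ] ℝ, ∀ v, ev v (fun i => f (b i)) = f v := fun f v => by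
    have : (topDualPairing ℝ (I → ℝ)).flip (fun i => f (b i)) ∘ₗ ev = f :=
      b.ext fun i => by simp [ev_basis]
    exact DFunLike.congr_fun this v
  have ev_surj : ∀ ψ : (I → ℝ) →L[ℝ] ℝ, ∃ v, ev v = ψ := fun ψ => by
    obtain ⟨s, c, hc⟩ := ψ.exists_finset_pi_apply_eq_sum
    refine ⟨∑ i ∈ s, c i • b i, ContinuousLinearMap.ext fun x => ?_⟩
    simp [hc, ev_basis]
  let ρ₀ : G → ((I → ℝ) →L[ℝ] (I → ℝ)) := fun g =>
    ContinuousLinearMap.pi fun i => ev (σ g⁻¹ (b i))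
  have ev_ρ : ∀ g v x, ev v (ρ₀ g x) = ev (σ g⁻¹ v) x := fun g v x => by
    have : (topDualPairing ℝ (I → ℝ)).flip (ρ₀ g x) ∘ₗ ev =
        (topDualPairing ℝ (I → ℝ)).flip x ∘ₗ ev ∘ₗ σ g⁻¹ :=
      b.ext fun i => by simp [ev_basis, ρ₀]
    exact DFunLike.congr_fun this v
  let ρ : G →* ((I → ℝ) →L[ℝ] (I → ℝ)) :=
    { toFun := ρ₀
      map_one' := ContinuousLinearMap.ext fun x => funext fun i => by
        rw [← ev_basis i (ρ₀ 1 x), ev_ρ]; simp [ev_basis]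
      map_mul' := fun g k => ContinuousLinearMap.ext fun x => funext fun i => by
        rw [← ev_basis i (ρ₀ _ x), ev_ρ, mul_apply_eq_comp, ← ev_basis i (ρ₀ g _), ev_ρ, ev_ρ]
        simp }
  have ev_dual : ∀ g v, ConeFPP.dualAct ρ g (ev v) = ev (σ g v) := fun g v =>
    ContinuousLinearMap.ext fun x => by
      change ev v (ρ₀ g⁻¹ x) = _
      rw [ev_ρ, inv_inv]
  let C : PointedCone ℝ (I → ℝ) :=
    { carrier := {x | ∀ p ∈ P, 0 ≤ ev p x}
      zero_mem' := fun p _ => by simp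
      add_mem' := fun hx hy p hp => by
        rw [map_add]; exact add_nonneg (hx p hp) (hy p hp)
      smul_mem' := fun r x hx p hp => by
        have : ev p (r • x) = (r : ℝ) * ev p x := (ev p).map_smul (r : ℝ) x
        rw [this]; exact mul_nonneg r.2 (hx p hp) }
  have mem_C : ∀ x, x ∈ C ↔ ∀ p ∈ P, 0 ≤ ev p x := fun x => Iff.rfl
  have hclosed : IsClosed (C : Set (I → ℝ)) := by
    have : (C : Set (I → ℝ)) = ⋂ p ∈ P, {x | 0 ≤ ev p x} := by ext x; simp [mem_C]
    rw [this]
    exact isClosed_biInter fun p _ => isClosed_le continuous_const (ev p).continuous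
  -- A form vanishing on `P` kills both `∑ σ (g i) φ ± v`, hence `v`.
  have hproper : ConeFPP.IsProperCone C := by
    refine Set.eq_singleton_iff_unique_mem.2 ⟨by simp, fun x ⟨hx, hx'⟩ => funext fun i => ?_⟩
    have hz : ∀ p ∈ P, ev p x = 0 := fun p hp => by
      have h1 := hx p hp
      have h2 : 0 ≤ ev p (-x) := hx' p hp
      rw [map_neg] at h2
      linarith
    obtain ⟨n, g, h1, h2⟩ := hφ (b i)
    have h1 := hz _ h1
    have h2 := hz _ h2
    rw [map_sub, sub_apply, ev_basis] at h1
    rw [map_add, add_apply, ev_basis] at h2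
    simp only [Pi.zero_apply]
    linarith
  have hpres : ConeFPP.PreservesCone ρ C := fun g x hx p hp => by
    change 0 ≤ ev p (ρ₀ g x)
    rw [ev_ρ]
    exact hx _ (hP _ _ hp)
  have hloc : ConeFPP.LocallyBoundedType ρ C := by
    refine ⟨fun i => f₀ (b i), fun p hp => ?_, fun h0 => hf₀ ?_, ?_⟩
    · rw [ev_repr]; exact hf₀P p hp
    · exact b.ext fun i => congrFun h0 i
    · rw [Bornology.isVonNBounded_pi_iff]
      intro i
      rw [NormedSpace.isVonNBounded_iff']
      obtain ⟨M, hM⟩ := hbdd (b i)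
      refine ⟨M, ?_⟩
      rintro _ ⟨_, ⟨g, rfl⟩, rfl⟩
      have : ρ g (fun i => f₀ (b i)) i = f₀ (σ g⁻¹ (b i)) := ev_repr f₀ _
      simpa [this] using hM g⁻¹
  have hcob : ConeFPP.CoboundedType ρ C := by
    refine ⟨ev φ, fun ψ => ?_⟩
    obtain ⟨v, rfl⟩ := ev_surj ψ
    obtain ⟨n, g, h1, h2⟩ := hφ v
    refine ⟨n, g, fun x hx => ?_, fun x hx => ?_⟩
    · have := hx _ h1
      simp_rw [ev_dual, ← map_sum]
      rw [map_sub, sub_apply] at this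
      linarith
    · have := hx _ h2
      simp_rw [ev_dual, ← map_sum]
      rw [map_add, add_apply] at this
      rw [neg_apply]
      linarith
  obtain ⟨x, hxC, hx0, hxρ⟩ :=
    h (I → ℝ) C ρ hproper (ConeFPP.isWeaklyComplete_pi hclosed) hpres hloc hcob
  have hinv : ∀ g v, ev (σ g v) x = ev v x := fun g v => by
    have := ev_ρ g⁻¹ v x
    rw [inv_inv] at this
    rw [← this]
    exact congrArg (ev v) (hxρ g⁻¹)
  -- Domination and invariance give `|x i| ≤ n * ev φ x`.
  have hpos : 0 < ev φ x := by
    obtain ⟨i, hi⟩ : ∃ i, x i ≠ 0 := Function.ne_iff.1 hx0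
    obtain ⟨n, g, h1, h2⟩ := hφ (b i)
    have h1 := hxC _ h1
    have h2 := hxC _ h2
    rw [map_sub, sub_apply, ev_basis, map_sum, sum_apply]
      at h1
    rw [map_add, add_apply, ev_basis, map_sum, sum_apply]
      at h2
    simp only [hinv, Finset.sum_const, Finset.card_univ, Fintype.card_fin, nsmul_eq_mul] at h1 h2
    have : 0 < |x i| := abs_pos.2 hi
    have h3 : |x i| ≤ n * ev φ x := abs_le.2 ⟨by linarith, by linarith⟩
    exact pos_of_mul_pos_right (this.trans_le h3) n.cast_nonneg
  refine ⟨(ev φ x)⁻¹ • (topDualPairing ℝ (I → ℝ)).flip x ∘ₗ ev, fun p hp => ?_,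
    fun g v => ?_, ?_⟩
  · exact mul_nonneg (inv_nonneg.2 hpos.le) (hxC p hp)
  · simp [hinv]
  · simp [hpos.ne']

/-- A space with a countable spanning set has a basis indexed by a countable type in any
universe. -/
theorem exists_countable_basis {V : Type w} [AddCommGroup V] [Module ℝ V] {s : Set V}
    (hs : s.Countable) (hspan : Submodule.span ℝ s = ⊤) :
    ∃ (I : Type v) (_ : Countable I), Nonempty (Module.Basis I ℝ V) := by
  obtain ⟨t, hts, ht, hli⟩ := exists_linearIndependent ℝ s
  have : Countable t := (hs.mono hts).to_subtype
  obtain ⟨e, he⟩ := exists_injective_nat t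
  let b : Module.Basis t ℝ V := Module.Basis.mk hli (by simp [ht, hspan])
  -- Indexing by a subset of `ℕ` frees the basis from the universe of `V`.
  exact ⟨ULift.{v} (Set.range e), inferInstance,
    ⟨b.reindex ((Equiv.ofInjective e he).trans Equiv.ulift.symm)⟩⟩

/-! ### Passage to arbitrary dimension -/

/-- Compactness: invariant positive functionals on the countably generated invariant subspaces
yield one on the whole space. -/
theorem exists_invariant {G : Type u} [Group G] [Countable G] {W : Type w} [AddCommGroup W]
    [Module ℝ W] (h : FixedPointPropertyForConesWeaklyFirstCountable.{u, v} G)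
    (σ : G →* (W →ₗ[ℝ] W)) (P : Set W) (hP : ∀ g, ∀ p ∈ P, σ g p ∈ P) (φ : W)
    (hφ : ∀ v, ∃ (n : ℕ) (g : Fin n → G),
      ∑ i, σ (g i) φ - v ∈ P ∧ ∑ i, σ (g i) φ + v ∈ P)
    (f₀ : W →ₗ[ℝ] ℝ) (hf₀ : f₀ ≠ 0) (hf₀P : ∀ p ∈ P, 0 ≤ f₀ p)
    (hbdd : ∀ v, ∃ M : ℝ, ∀ g, |f₀ (σ g v)| ≤ M) :
    ∃ f : W →ₗ[ℝ] ℝ, (∀ p ∈ P, 0 ≤ f p) ∧ (∀ g v, f (σ g v) = f v) ∧ f φ = 1 := by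
  classical
  obtain ⟨w, hw⟩ : ∃ w, f₀ w ≠ 0 := by
    by_contra! hcon
    exact hf₀ (LinearMap.ext hcon)
  -- The bound `n` does not depend on `F`; this gives the compactness.
  have key : ∀ F : Finset W, ∃ f : W →ₗ[ℝ] ℝ, (∀ p ∈ P, p ∈ F → 0 ≤ f p) ∧
      (∀ v ∈ F, ∀ g, f (σ g v) = f v) ∧ f φ = 1 ∧
      ∀ v ∈ F, ∀ (n : ℕ) (g : Fin n → G), ∑ i, σ (g i) φ - v ∈ P →
        ∑ i, σ (g i) φ + v ∈ P → |f v| ≤ n := by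
    intro F
    -- Including `w` keeps `f₀` non-zero on the span.
    let S : Set W := ⋃ v ∈ insert φ (insert w F), Set.range fun g => σ g v
    have hS : S.Countable := (Finset.countable_toSet _).biUnion fun v _ => Set.countable_range _
    let V : Submodule ℝ W := Submodule.span ℝ S
    have hσV : ∀ g, ∀ v ∈ V, σ g v ∈ V := fun g => by
      change V ≤ V.comap (σ g)
      refine Submodule.span_le.2 fun v hv => ?_
      simp only [S, Set.mem_iUnion] at hv
      obtain ⟨u, hu, k, rfl⟩ := hv
      refine Submodule.subset_span ?_
      simp only [S, Set.mem_iUnion]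
      exact ⟨u, hu, g * k, by simp⟩
    have hmem : ∀ v ∈ insert φ (insert w F), v ∈ V := fun v hv => by
      refine Submodule.subset_span ?_
      simp only [S, Set.mem_iUnion]
      exact ⟨v, hv, 1, by simp⟩
    have hφV : φ ∈ V := hmem φ (by simp)
    have hwV : w ∈ V := hmem w (by simp)
    have hFV : ∀ v ∈ F, v ∈ V := fun v hv => hmem v (by simp [hv])
    obtain ⟨I, _, ⟨b⟩⟩ := exists_countable_basis.{v} (V := V) (s := Subtype.val ⁻¹' S)
      (hS.preimage Subtype.val_injective) (Submodule.span_span_coe_preimage)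
    let τ : G →* (V →ₗ[ℝ] V) :=
      { toFun := fun g => (σ g).restrict (hσV g)
        map_one' := by ext; simp
        map_mul' := fun g k => by ext; simp }
    have hτ : ∀ g (v : V), (τ g v : W) = σ g v := fun _ _ => rfl
    obtain ⟨f, hfP, hfσ, hfφ⟩ := exists_invariant_of_basis b h τ (Subtype.val ⁻¹' P)
      (fun g p hp => hP g _ hp) ⟨φ, hφV⟩
      (fun v => by
        obtain ⟨n, g, h1, h2⟩ := hφ v
        exact ⟨n, g, by simpa [hτ] using h1, by simpa [hτ] using h2⟩)
      (f₀ ∘ₗ V.subtype) (fun h0 => hw (DFunLike.congr_fun h0 ⟨w, hwV⟩))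
      (fun p hp => hf₀P _ hp) (fun v => hbdd v)
    -- Any linear extension will do: positivity and invariance are needed only on `V`.
    obtain ⟨f', hf'⟩ := LinearMap.exists_extend f
    have hext : ∀ v (hv : v ∈ V), f' v = f ⟨v, hv⟩ := fun v hv =>
      DFunLike.congr_fun hf' (⟨v, hv⟩ : V)
    have hinv : ∀ v ∈ V, ∀ g, f' (σ g v) = f' v := fun v hv g => by
      rw [hext v hv, hext _ (hσV g v hv)]
      exact hfσ g ⟨v, hv⟩
    have h1 : f' φ = 1 := by rw [hext φ hφV, hfφ]
    have hpos : ∀ p ∈ P, p ∈ V → 0 ≤ f' p := fun p hp hpV => by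
      rw [hext p hpV]; exact hfP _ hp
    refine ⟨f', fun p hp hpF => hpos p hp (hFV p hpF), fun v hv g => hinv v (hFV v hv) g, h1,
      fun v hv n g hm hp => ?_⟩
    have hsum : ∑ i, σ (g i) φ ∈ V := V.sum_mem fun i _ => hσV _ _ hφV
    have hval : f' (∑ i, σ (g i) φ) = n := by simp [hinv φ hφV, h1]
    have h2 := hpos _ hm (V.sub_mem hsum (hFV v hv))
    have h3 := hpos _ hp (V.add_mem hsum (hFV v hv))
    rw [map_sub, hval] at h2
    rw [map_add, hval] at h3
    exact abs_le.2 ⟨by linarith, by linarith⟩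
  choose f hfP hfσ hfφ hfb using key
  let U : Ultrafilter (Finset W) := Ultrafilter.of atTop
  have hU : ∀ v, ∀ᶠ F in (U : Filter (Finset W)), v ∈ F := fun v =>
    (Ultrafilter.of_le atTop) (by
      filter_upwards [eventually_ge_atTop {v}] with F hF
      exact hF (Finset.mem_singleton_self v))
  have hlim : ∀ v, ∃ y, Tendsto (fun F => f F v) U (𝓝 y) := fun v => by
    obtain ⟨n, g, h1, h2⟩ := hφ v
    have hev : ∀ᶠ F in (U : Filter (Finset W)), f F v ∈ Set.Icc (-(n : ℝ)) n := by
      filter_upwards [hU v] with F hF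
      exact abs_le.1 (hfb F v hF n g h1 h2)
    obtain ⟨y, -, hy⟩ := isCompact_Icc.ultrafilter_le_nhds (U.map fun F => f F v)
      (le_principal_iff.2 hev)
    exact ⟨y, hy⟩
  choose y hy using hlim
  let l : W →ₗ[ℝ] ℝ := linearMapOfTendsto y f (tendsto_pi_nhds.2 hy)
  refine ⟨l, fun p hp => ?_, fun g v => ?_, ?_⟩
  · refine ge_of_tendsto (hy p) ?_
    filter_upwards [hU p] with F hF
    exact hfP F p hp hF
  · refine tendsto_nhds_unique_of_eventuallyEq (hy (σ g v)) (hy v) ?_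
    filter_upwards [hU v] with F hF
    exact hfσ F v hF g
  · exact tendsto_nhds_unique (hy φ) (by simp [hfφ])

/-! ### Representation by points of the cone -/

/-- A linear form on the dual which is non-negative on the dual cone of a weakly complete cone is
the evaluation at a point of the cone. -/
theorem ConeFPP.IsWeaklyComplete.exists_eval_eq {E : Type w} [AddCommGroup E] [Module ℝ E]
    [TopologicalSpace E] [IsTopologicalAddGroup E] [ContinuousSMul ℝ E] {C : PointedCone ℝ E}
    (hC : ConeFPP.IsWeaklyComplete C) (f : (E →L[ℝ] ℝ) →ₗ[ℝ] ℝ)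
    (hf : ∀ ψ : E →L[ℝ] ℝ, (∀ x ∈ C, 0 ≤ ψ x) → 0 ≤ f ψ) :
    ∃ x ∈ C, ∀ ψ, f ψ = ψ x := by
  unfold ConeFPP.IsWeaklyComplete at hC
  let : UniformSpace (WeakSpace ℝ E) := IsTopologicalAddGroup.rightUniformSpace (WeakSpace ℝ E)
  have : IsUniformAddGroup (WeakSpace ℝ E) := isUniformAddGroup_of_addCommGroup
  let j : E →ₗ[ℝ] ((E →L[ℝ] ℝ) → ℝ) := LinearMap.pi fun ψ => ψ.toLinearMap
  let j' : WeakSpace ℝ E →ₗ[ℝ] ((E →L[ℝ] ℝ) → ℝ) := j ∘ₗ (toWeakSpace ℝ E).symm.toLinearMap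
  have hj' : IsUniformInducing j' :=
    AddMonoidHom.isUniformInducing_of_isInducing (f := j') ⟨rfl⟩
  -- The weak uniform structure is induced from the product by `j'`, so the image of `C` is
  -- complete.
  have hclosed : IsClosed (j '' (C : Set E)) := by
    have := ((isComplete_image_iff hj').2 hC).isClosed
    rw [Set.image_image] at this
    exact this
  by_cases hmem : (fun ψ => f ψ) ∈ j '' (C : Set E)
  · obtain ⟨x, hx, hxf⟩ := hmem
    exact ⟨x, hx, fun ψ => (congrFun hxf ψ).symm⟩
  have hconv : Convex ℝ (j '' (C : Set E)) := C.convex.linear_image j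
  obtain ⟨L, u, hL, hu⟩ := geometric_hahn_banach_closed_point hconv hclosed hmem
  obtain ⟨s, c, hc⟩ := L.exists_finset_pi_apply_eq_sum
  let ψ : E →L[ℝ] ℝ := ∑ i ∈ s, c i • i
  have hψ : ∀ x, L (j x) = ψ x := fun x => by simp [hc, ψ, j]
  have hfψ : L (fun ψ => f ψ) = f ψ := by simp [hc, ψ]
  have hu0 : 0 < u := by simpa using hL (j 0) ⟨0, C.zero_mem, rfl⟩
  -- A form bounded above on a cone is non-positive there: otherwise rescaling `x` attains the bound
  -- `u`.
  have hneg : ∀ x ∈ C, 0 ≤ (-ψ) x := fun x hx => by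
    by_contra! hlt
    have hpos : 0 < ψ x := by simpa using hlt
    have := hL (j ((u / ψ x) • x))
      ⟨_, C.smul_mem (div_pos hu0 hpos).le hx, rfl⟩
    rw [hψ, map_smul, smul_eq_mul, div_mul_cancel₀ _ hpos.ne'] at this
    exact lt_irrefl _ this
  have := hf (-ψ) hneg
  rw [map_neg] at this
  linarith

theorem mainTheorem11 (G : Type u) [Group G] [Countable G]
    (h : FixedPointPropertyForConesWeaklyFirstCountable.{u, v} G) :
    FixedPointPropertyForCones.{u, w} G := by
  intro E _ _ _ _ _ _ _ C ρ _ hC hρ hloc hcob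
  obtain ⟨x₀, hx₀C, hx₀, hbdd⟩ := hloc
  obtain ⟨φ, hφ⟩ := hcob
  let σ : G →* ((E →L[ℝ] ℝ) →ₗ[ℝ] (E →L[ℝ] ℝ)) :=
    { toFun := fun g =>
        { toFun := ConeFPP.dualAct ρ g
          map_add' := fun _ _ => rfl
          map_smul' := fun _ _ => rfl }
      map_one' := LinearMap.ext fun ψ => by
        change ConeFPP.dualAct ρ 1 ψ = ψ
        ext; simp [ConeFPP.dualAct]
      map_mul' := fun g k => LinearMap.ext fun ψ => by
        change ConeFPP.dualAct ρ (g * k) ψ = ConeFPP.dualAct ρ g (ConeFPP.dualAct ρ k ψ)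
        ext; simp [ConeFPP.dualAct] }
  have hσ : ∀ g ψ x, σ g ψ x = ψ (ρ g⁻¹ x) := fun _ _ _ => rfl
  let f₀ : (E →L[ℝ] ℝ) →ₗ[ℝ] ℝ := (topDualPairing ℝ E).flip x₀
  have hf₀ : f₀ ≠ 0 := fun h0 => by
    obtain ⟨ψ, hψ⟩ := SeparatingDual.exists_ne_zero (R := ℝ) hx₀
    exact hψ (DFunLike.congr_fun h0 ψ)
  obtain ⟨f, hfP, hfσ, hfφ⟩ := exists_invariant h σ {ψ | ∀ x ∈ C, 0 ≤ ψ x}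
    (fun g p hp x hx => hp _ (hρ _ _ hx)) φ
    (fun ψ => by
      obtain ⟨n, g, h1, h2⟩ := hφ ψ
      refine ⟨n, g, fun x hx => ?_, fun x hx => ?_⟩
      · have : ψ x ≤ (∑ i, σ (g i) φ) x := h1 x hx
        rw [sub_apply]
        linarith
      · have : -ψ x ≤ (∑ i, σ (g i) φ) x := h2 x hx
        rw [add_apply]
        linarith)
    f₀ hf₀ (fun p hp => hp _ hx₀C)
    (fun ψ => by
      obtain ⟨M, hM⟩ := (NormedSpace.isVonNBounded_iff' ℝ).1 (hbdd.image ψ)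
      exact ⟨M, fun g => hM _ ⟨_, ⟨g⁻¹, rfl⟩, rfl⟩⟩)
  obtain ⟨x, hxC, hx⟩ := hC.exists_eval_eq f hfP
  refine ⟨x, hxC, fun h0 => ?_, fun g => ?_⟩
  · rw [hx, h0, map_zero] at hfφ
    exact zero_ne_one hfφ
  · refine (SeparatingDual.eq_iff_forall_dual_eq (R := ℝ)).2 fun ψ => ?_
    have := hfσ g⁻¹ ψ
    rw [hx, hx, hσ, inv_inv] at this
    exact this
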